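/- Let $V$ be a finite-dimensional real inner product space and let $W \subset \mathrm{O}(V)$ be a finite group generated by orthogonal reflections at hyperplanes. Suppose that $W$ is almost irreducible, i.e. $V = V_1 \oplus V_2$ with $W$-invariant subspaces $V_1, V_2$ such that $W$ acts irreducibly and nontrivially on $V_1$ and trivially on $V_2$, and $\dim V_2 = 1$. Let $C \subset V$ be a monoconditional symmetric cone, i.e. a $W$-invariant convex polyhedral cone for which there is a linear form $\phi \in V^*$ with $V_1 \not\subset \ker\phi$, $V_2 \not\subset \ker \phi$ and \[ C = \{ x \in V \mid \forall \sigma \in W : \phi(\sigma x) \geq 0 \}. \tag{1} \] Let $F \subset V$ be a fundamental domain for $W$, i.e. the closure of an open subset of $V$ that meets each $W$-orbit in exactly one point. Then: (a) $C_+ := C \cap F$ is a simplicial cone, i.e. it is generated by a finite linearly independent set of vectors. (b) For every linear form $\phi$ with $V_1 \not\subset \ker\phi$ and $V_2 \not\subset \ker \phi$ that satisfies (1), let $x_\phi \in V$ be the vector with $\phi(x) = -(x, x_\phi)$ for all $x \in V$, and let $x_0$ be the unique element of $W x_\phi \cap F$. Then $C_+ = \{ x \in F \mid (x, x_0) \leq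 0 \}$. (c) $C = \bigcup_{\sigma \in W} \sigma C_+$, and this is a triangulation of $C$: the set of all faces of the cones $\sigma C_+$, $\sigma \in W$, is a finite set of simplicial cones with union $C$ that is closed under taking faces, and any two of its members intersect in a common face of both. -/

import Mathlib

namespace ReflCone

variable {V : Type*} [NormedAddCommGroup V] [InnerProductSpace ℝ V]

/-- `s` is the orthogonal reflection at the hyperplane orthogonal to some nonzero vector. -/
def IsHyperplaneReflection (s : V ≃ₗᵢ[ℝ] V) : Prop :=
  ∃ v : V, v ≠ 0 ∧ s = (ℝ ∙ v)ᗮ.reflection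

/-- A finite reflection group: a finite subgroup of `O(V)` generated by reflections. -/
def IsFiniteReflectionGroup (W : Subgroup (V ≃ₗᵢ[ℝ] V)) : Prop :=
  Finite W ∧ ∃ S : Set (V ≃ₗᵢ[ℝ] V), (∀ s ∈ S, IsHyperplaneReflection s) ∧ Subgroup.closure S = W

def IsInvariantSubspace (W : Subgroup (V ≃ₗᵢ[ℝ] V)) (U : Submodule ℝ V) : Prop :=
  ∀ σ ∈ W, ∀ x ∈ U, σ x ∈ U

/-- `W` is an almost irreducible finite reflection group, with decomposition `V = V₁ ⊕ V₂`. -/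
structure IsAlmostIrreducible (W : Subgroup (V ≃ₗᵢ[ℝ] V)) (V₁ V₂ : Submodule ℝ V) : Prop where
  reflectionGroup : IsFiniteReflectionGroup W
  isCompl : IsCompl V₁ V₂
  invariant_left : IsInvariantSubspace W V₁
  invariant_right : IsInvariantSubspace W V₂
  ne_bot : V₁ ≠ ⊥
  irreducible : ∀ U : Submodule ℝ V, U ≤ V₁ → IsInvariantSubspace W U → U = ⊥ ∨ U = V₁
  nontrivial : ∃ σ ∈ W, ∃ x ∈ V₁, σ x ≠ x
  trivial : ∀ σ ∈ W, ∀ x ∈ V₂, σ x = x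
  finrank_eq_one : Module.finrank ℝ V₂ = 1

/-- The orbit of `x` under `W`. -/
def orbit (W : Subgroup (V ≃ₗᵢ[ℝ] V)) (x : V) : Set V := {y | ∃ σ ∈ W, y = σ x}

/-- `F` is the closure of an open set and meets every `W`-orbit in exactly one point. -/
def IsFundamentalDomain (W : Subgroup (V ≃ₗᵢ[ℝ] V)) (F : Set V) : Prop :=
  (∃ U : Set V, IsOpen U ∧ F = closure U) ∧ ∀ x : V, ∃! y : V, y ∈ orbit W x ∧ y ∈ F

/-- A convex polyhedral cone: the solution set of finitely many homogeneous linear inequalities. -/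
def IsPolyhedral (C : PointedCone ℝ V) : Prop :=
  ∃ S : Finset (Module.Dual ℝ V), ∀ x : V, x ∈ C ↔ ∀ f ∈ S, 0 ≤ f x

/-- The image `σ C` of a cone under an orthogonal map. -/
def translate (σ : V ≃ₗᵢ[ℝ] V) (C : PointedCone ℝ V) : PointedCone ℝ V :=
  C.map (σ.toLinearEquiv : V →ₗ[ℝ] V)

/-- A symmetric cone: a convex polyhedral cone invariant under `W`. -/
def IsSymmetricCone (W : Subgroup (V ≃ₗᵢ[ℝ] V)) (C : PointedCone ℝ V) : Prop :=
  IsPolyhedral C ∧ ∀ σ ∈ W, translate σ C = C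

/-- The linear form `φ` exhibits the cone `C` as monoconditional. -/
structure IsDefiningForm (W : Subgroup (V ≃ₗᵢ[ℝ] V)) (V₁ V₂ : Submodule ℝ V)
    (C : PointedCone ℝ V) (φ : Module.Dual ℝ V) : Prop where
  not_le_left : ¬ V₁ ≤ LinearMap.ker φ
  not_le_right : ¬ V₂ ≤ LinearMap.ker φ
  mem_iff : ∀ x : V, x ∈ C ↔ ∀ σ ∈ W, 0 ≤ φ (σ x)

/-- A monoconditional symmetric cone. -/
def IsMonoconditional (W : Subgroup (V ≃ₗᵢ[ℝ] V)) (V₁ V₂ : Submodule ℝ V)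
    (C : PointedCone ℝ V) : Prop :=
  IsSymmetricCone W C ∧ ∃ φ : Module.Dual ℝ V, IsDefiningForm W V₁ V₂ C φ

/-- `T` is a triangulation of the cone `C`: a finite set of simplicial cones with union `C`,
closed under taking faces, any two of which intersect in a common face. -/
structure IsTriangulation (C : PointedCone ℝ V) (T : Set (PointedCone ℝ V)) : Prop where
  finite : T.Finite
  simplicial : ∀ G ∈ T, G.IsSimplicial
  face_mem : ∀ G ∈ T, ∀ G' : PointedCone ℝ V, G'.IsFaceOf G → G' ∈ T
  inter_face : ∀ G ∈ T, ∀ G' ∈ T, (G ⊓ G').IsFaceOf G ∧ (G ⊓ G').IsFaceOf G'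
  union : (C : Set V) = ⋃ G ∈ T, (G : Set V)

end ReflCone

namespace ReflCone

/-! ### Fundamental domains as Dirichlet domains -/

section FundamentalDomain

variable {V : Type*} [NormedAddCommGroup V] [InnerProductSpace ℝ V]
  {W : Subgroup (V ≃ₗᵢ[ℝ] V)} {F : Set V}

/-! Everything rests on one inequality, `inner_apply_le`: for `x, y ∈ F`, no image of `y` has larger
inner product with `x` than `y` itself. Applied to the orbit of `xφ`, it says that on `F` the
condition at `x₀` implies all the others; this is (b).

For (a), `F` is a chamber of the reflection arrangement, cut out by linearly independent normals
because a minimal set of them is pairwise obtuse (`exists_linearIndependent_normals`). Almost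
irreducibility leaves only the line `V₂` orthogonal to these normals, and `φ` does not vanish there.
Adding `-x₀` thus gives a basis of `V`, and `C ∩ F` is its dual cone, hence simplicial.

For (c), the inequality and the fact that `F` spans `V` show that a sum of points of `F` is fixed by
`σ` only if the summands are (`apply_eq_self_of_add`). Two translates of `C ∩ F` meet exactly in
such fixed points, so they meet in a common face. -/

theorem smul_mem_orbit {σ : V ≃ₗᵢ[ℝ] V} (hσ : σ ∈ W) (x : V) : σ x ∈ orbit W x := ⟨σ, hσ, rfl⟩

theorem mem_orbit_self (x : V) : x ∈ orbit W x := ⟨1, W.one_mem, rfl⟩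

theorem inv_apply_eq_of_apply_eq {σ : V ≃ₗᵢ[ℝ] V} {x y : V} (h : σ x = y) : σ⁻¹ y = x := by
  rw [← h]
  exact σ.symm_apply_apply x

/-- Isometries move across the inner product by their inverse. -/
theorem inner_apply_right (σ : V ≃ₗᵢ[ℝ] V) (x y : V) :
    inner ℝ x (σ y) = inner ℝ (σ⁻¹ x) y := by
  rw [← σ.inner_map_map (σ⁻¹ x) y]
  congr 1
  exact (σ.apply_symm_apply x).symm

/-- `x` has trivial stabilizer in `W`. -/
def IsFree (W : Subgroup (V ≃ₗᵢ[ℝ] V)) (x : V) : Prop := ∀ σ ∈ W, σ x = x → σ = 1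

namespace IsFundamentalDomain

theorem isClosed (hF : IsFundamentalDomain W F) : IsClosed F := by
  obtain ⟨⟨U, -, rfl⟩, -⟩ := hF
  exact isClosed_closure

theorem exists_mem (hF : IsFundamentalDomain W F) (x : V) : ∃ σ ∈ W, σ x ∈ F := by
  obtain ⟨y, ⟨⟨σ, hσ, rfl⟩, hy⟩, -⟩ := hF.2 x
  exact ⟨σ, hσ, hy⟩

theorem apply_eq_self (hF : IsFundamentalDomain W F) {σ : V ≃ₗᵢ[ℝ] V} (hσ : σ ∈ W) {x : V}
    (hx : x ∈ F) (hσx : σ x ∈ F) : σ x = x :=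
  (hF.2 x).unique ⟨smul_mem_orbit hσ x, hσx⟩ ⟨mem_orbit_self x, hx⟩

/-- A fundamental domain spans the space. -/
theorem eq_zero_of_inner_eq_zero (hF : IsFundamentalDomain W F) {z : V}
    (hz : ∀ y ∈ F, inner ℝ z y = 0) : z = 0 := by
  obtain ⟨U, hU, rfl⟩ := hF.1
  have hne : U.Nonempty := by
    obtain ⟨σ, -, h⟩ := hF.exists_mem 0
    exact closure_nonempty_iff.1 ⟨_, h⟩
  have htop : (ℝ ∙ z)ᗮ = ⊤ := by
    refine Submodule.eq_top_of_nonempty_interior' _ (hne.mono ?_)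
    exact interior_maximal (fun y hy =>
      Submodule.mem_orthogonal_singleton_iff_inner_right.2 (hz y (subset_closure hy))) hU
  have : z ∈ (ℝ ∙ z)ᗮ := htop ▸ Submodule.mem_top
  exact inner_self_eq_zero.1 (Submodule.mem_orthogonal_singleton_iff_inner_right.1 this)

/-- A half-open segment of points with trivial stabilizer that starts in `F` stays in `F`. -/
theorem mem_of_segment_free [Finite W] (hF : IsFundamentalDomain W F) {p y : V} (hp : p ∈ F)
    (h : ∀ t ∈ Set.Ico (0 : ℝ) 1, IsFree W ((1 - t) • p + t • y)) : y ∈ F := by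
  set g : ℝ → V := fun t => (1 - t) • p + t • y with hg
  have hgc : Continuous g := by fun_prop
  -- `F` and `B` are closed, cover `V`, and overlap only in points with nontrivial stabilizer. A
  -- connected set of free points that meets `F` therefore avoids `B`.
  set B : Set V := ⋃ σ : {σ : W // σ ≠ 1}, (fun x => (σ : V ≃ₗᵢ[ℝ] V) x) ⁻¹' F
  have hBc : IsClosed B := isClosed_iUnion_of_finite fun σ =>
    hF.isClosed.preimage (σ : V ≃ₗᵢ[ℝ] V).continuous
  have hsub : Set.Ico (0 : ℝ) 1 ⊆ g ⁻¹' F := by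
    by_contra hcon
    obtain ⟨t, ht, htF⟩ := Set.not_subset.1 hcon
    have hcover : ∀ z, z ∉ F → z ∈ B := by
      intro z hz
      obtain ⟨σ, hσ, hσz⟩ := hF.exists_mem z
      refine Set.mem_iUnion.2 ⟨⟨⟨σ, hσ⟩, ?_⟩, hσz⟩
      rintro h1
      obtain rfl : σ = 1 := congrArg Subtype.val h1
      exact hz hσz
    obtain ⟨s, hs, hsF, hsB⟩ :=
      isPreconnected_closed_iff.1 (isPreconnected_Ico (a := (0 : ℝ)) (b := 1))
      (g ⁻¹' F) (g ⁻¹' B) (hF.isClosed.preimage hgc) (hBc.preimage hgc)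
      (fun r _ => or_iff_not_imp_left.2 fun hr => hcover _ hr)
      ⟨0, by simp, by simpa [hg] using hp⟩ ⟨t, ht, hcover _ htF⟩
    obtain ⟨⟨⟨σ, hσ⟩, hne⟩, hσs⟩ := Set.mem_iUnion.1 hsB
    exact hne (Subtype.ext (h s hs σ hσ (hF.apply_eq_self hσ hsF hσs)))
  have h1 : (1 : ℝ) ∈ closure (Set.Ico (0 : ℝ) 1) := by
    rw [closure_Ico zero_ne_one]; simp
  have := closure_minimal hsub (hF.isClosed.preimage hgc) h1
  simpa [hg] using this

end IsFundamentalDomain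

/-- A point with trivial stabilizer is strictly closer to itself than to its other images. -/
theorem IsFree.inner_apply_lt {p : V} (hp : IsFree W p) {σ : V ≃ₗᵢ[ℝ] V} (hσ : σ ∈ W)
    (hne : σ ≠ 1) : inner ℝ p (σ p) < inner ℝ p p := by
  have h0 : p - σ p ≠ 0 := fun h => hne (hp σ hσ (sub_eq_zero.1 h).symm)
  have h1 : 0 < inner ℝ (p - σ p) (p - σ p) := by
    rw [real_inner_self_eq_norm_sq]; positivity
  rw [inner_sub_left, inner_sub_right, inner_sub_right, σ.inner_map_map,
    real_inner_comm p (σ p)] at h1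
  linarith

namespace IsFundamentalDomain

/-- A fundamental domain is the Dirichlet domain of each of its points with trivial stabilizer. -/
theorem mem_iff_of_isFree [Finite W] (hF : IsFundamentalDomain W F) {p : V} (hp : p ∈ F)
    (hfree : IsFree W p) (y : V) : y ∈ F ↔ ∀ σ ∈ W, inner ℝ y (σ p) ≤ inner ℝ y p := by
  have key : ∀ y : V, (∀ σ ∈ W, inner ℝ y (σ p) ≤ inner ℝ y p) → y ∈ F := by
    intro y hy
    -- A point of the segment fixed by `σ` has equal inner products with `p` and `σ⁻¹ p`, but `p`
    -- wins strictly at the end `p`, whose weight is positive, and weakly at `y`.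
    refine hF.mem_of_segment_free hp fun t ht σ hσ hfix => ?_
    by_contra hne
    have h1 := hfree.inner_apply_lt (W.inv_mem hσ) (inv_ne_one.2 hne)
    have h2 := hy _ (W.inv_mem hσ)
    have h3 : inner ℝ ((1 - t) • p + t • y) (σ⁻¹ p) = inner ℝ ((1 - t) • p + t • y) p := by
      rw [inner_apply_right, inv_inv, hfix]
    simp only [inner_add_left, real_inner_smul_left] at h3
    nlinarith [mul_lt_mul_of_pos_left h1 (sub_pos.2 ht.2), mul_le_mul_of_nonneg_left h2 ht.1]
  refine ⟨fun hy => ?_, key y⟩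
  -- The best image of `y` lies in `F` by `key`, so it is `y` itself.
  obtain ⟨τ, hτ⟩ := Finite.exists_max fun τ : W => inner ℝ ((τ : V ≃ₗᵢ[ℝ] V) y) p
  have hτy : (τ : V ≃ₗᵢ[ℝ] V) y ∈ F := by
    refine key _ fun σ hσ => ?_
    rw [inner_apply_right]
    exact hτ (⟨σ⁻¹, W.inv_mem hσ⟩ * τ)
  have heq := hF.apply_eq_self τ.2 hy hτy
  intro σ hσ
  have := hτ ⟨σ⁻¹, W.inv_mem hσ⟩
  rwa [heq, ← inner_apply_right] at this

end IsFundamentalDomain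

/-- The fixed space of an isometry. -/
def fixedSpace (σ : V ≃ₗᵢ[ℝ] V) : Submodule ℝ V :=
  LinearMap.eqLocus (σ.toLinearEquiv : V →ₗ[ℝ] V) LinearMap.id

theorem mem_fixedSpace {σ : V ≃ₗᵢ[ℝ] V} {x : V} : x ∈ fixedSpace σ ↔ σ x = x := Iff.rfl

theorem fixedSpace_eq_top_iff {σ : V ≃ₗᵢ[ℝ] V} : fixedSpace σ = ⊤ ↔ σ = 1 := by
  refine ⟨fun h => LinearIsometryEquiv.ext fun x => ?_, ?_⟩
  · exact mem_fixedSpace.1 (h ▸ Submodule.mem_top)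
  · rintro rfl
    exact eq_top_iff.2 fun x _ => rfl

section FiniteDimensional

variable [FiniteDimensional ℝ V]

/-- Finitely many proper subspaces do not cover a nonempty open set. -/
theorem dense_iInter_compl_submodule {ι : Type*} [Finite ι] (K : ι → Submodule ℝ V)
    (hK : ∀ i, K i ≠ ⊤) : Dense (⋂ i, ((K i : Set V)ᶜ)) := by
  refine dense_iInter_of_isOpen (fun i => (K i).closed_of_finiteDimensional.isOpen_compl)
    fun i => interior_eq_empty_iff_dense_compl.1 ?_
  by_contra h
  exact hK i ((K i).eq_top_of_nonempty_interior' (Set.nonempty_iff_ne_empty.2 h))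

theorem dense_isFree [Finite W] : Dense {x : V | IsFree W x} := by
  refine (dense_iInter_compl_submodule (fun σ : {σ : W // σ ≠ 1} => fixedSpace (σ : V ≃ₗᵢ[ℝ] V))
    fun σ h => σ.2 (Subtype.ext (fixedSpace_eq_top_iff.1 h))).mono fun x hx σ hσ h => ?_
  by_contra hne
  exact Set.mem_iInter.1 hx ⟨⟨σ, hσ⟩, fun h => hne (congrArg Subtype.val h)⟩ h

namespace IsFundamentalDomain

/-- Stabilizers along an orbit are conjugate, so a free point can be moved into `F`. -/
theorem exists_isFree [Finite W] (hF : IsFundamentalDomain W F) : ∃ p ∈ F, IsFree W p := by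
  obtain ⟨q, hq⟩ := (dense_isFree (W := W)).nonempty
  obtain ⟨σ, hσ, hσq⟩ := hF.exists_mem q
  refine ⟨σ q, hσq, fun τ hτ h => ?_⟩
  have h1 := hq (σ⁻¹ * τ * σ) (W.mul_mem (W.mul_mem (W.inv_mem hσ) hτ) hσ)
    (inv_apply_eq_of_apply_eq h.symm)
  have h2 : τ = σ * (σ⁻¹ * τ * σ) * σ⁻¹ := by group
  rw [h2, h1]; group

/-- Among the images of a point of `F`, the one in `F` is the closest to every point of `F`. -/
theorem inner_apply_le [Finite W] (hF : IsFundamentalDomain W F) {x y : V} (hx : x ∈ F)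
    (hy : y ∈ F) {σ : V ≃ₗᵢ[ℝ] V} (hσ : σ ∈ W) : inner ℝ x (σ y) ≤ inner ℝ x y := by
  have hcl : IsClosed {z : V | inner ℝ x (σ z) ≤ inner ℝ x z} :=
    isClosed_le (by fun_prop) (by fun_prop)
  obtain ⟨U, hU, rfl⟩ := hF.1
  -- For free `z` this is the Dirichlet description of `F` centred at `z`; density of free points
  -- extends it to all of `F`.
  have hsub : closure (U ∩ {z | IsFree W z}) ⊆ {z : V | inner ℝ x (σ z) ≤ inner ℝ x z} :=
    closure_minimal (fun z hz =>
      (hF.mem_iff_of_isFree (subset_closure hz.1) hz.2 x).1 hx σ hσ) hcl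
  exact hsub (closure_minimal (dense_isFree.open_subset_closure_inter hU) isClosed_closure hy)

/-- If a sum of points of `F` is fixed by `σ`, then so are the summands. -/
theorem apply_eq_self_of_add [Finite W] (hF : IsFundamentalDomain W F) {σ : V ≃ₗᵢ[ℝ] V}
    (hσ : σ ∈ W) {x y : V} (hx : x ∈ F) (hy : y ∈ F) (h : σ (x + y) = x + y) : σ x = x := by
  -- Against any `z ∈ F`, `σ x - x` and `σ y - y` have nonpositive inner products that sum to zero.
  refine sub_eq_zero.1 (hF.eq_zero_of_inner_eq_zero fun z hz => ?_)
  have h1 := hF.inner_apply_le hz hx hσ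
  have h2 := hF.inner_apply_le hz hy hσ
  have h3 : inner ℝ z (σ (x + y)) = inner ℝ z (x + y) := by rw [h]
  rw [map_add, inner_add_right, inner_add_right] at h3
  rw [real_inner_comm, inner_sub_right]
  linarith

end IsFundamentalDomain

end FiniteDimensional

end FundamentalDomain

end ReflCone

namespace ReflCone

/-! ### Reflecting hyperplanes and the walls of a chamber -/

section Walls

variable {V : Type*} [NormedAddCommGroup V] [InnerProductSpace ℝ V]
  {W : Subgroup (V ≃ₗᵢ[ℝ] V)} {F : Set V}

theorem hyperplaneReflection_apply (u x : V) :
    (ℝ ∙ u)ᗮ.reflection x = x - (2 * (inner ℝ u x / ‖u‖ ^ 2)) • u := by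
  rw [Submodule.reflection_orthogonal_apply, Submodule.reflection_singleton_apply]
  simp only [RCLike.ofReal_real_eq_id, id_eq, two_smul, two_mul, add_smul]
  abel

theorem hyperplaneReflection_apply_eq_self_iff (u x : V) :
    (ℝ ∙ u)ᗮ.reflection x = x ↔ inner ℝ x u = 0 := by
  rw [Submodule.reflection_eq_self_iff, Submodule.mem_orthogonal_singleton_iff_inner_left]

/-- The reflection at the image of a hyperplane is conjugate to the reflection at the hyperplane. -/
theorem hyperplaneReflection_map (σ : V ≃ₗᵢ[ℝ] V) (u : V) :
    (ℝ ∙ σ u)ᗮ.reflection = σ * (ℝ ∙ u)ᗮ.reflection * σ⁻¹ := by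
  ext x
  change _ = σ ((ℝ ∙ u)ᗮ.reflection (σ⁻¹ x))
  rw [hyperplaneReflection_apply, hyperplaneReflection_apply, map_sub, map_smul, σ.norm_map,
    real_inner_comm, inner_apply_right, real_inner_comm]
  congr 1
  exact (σ.apply_symm_apply x).symm

theorem IsHyperplaneReflection.ne_one {σ : V ≃ₗᵢ[ℝ] V} (h : IsHyperplaneReflection σ) : σ ≠ 1 := by
  obtain ⟨v, hv, rfl⟩ := h
  intro h1
  have := (hyperplaneReflection_apply_eq_self_iff v v).1 (by rw [h1]; rfl)
  exact hv (inner_self_eq_zero.1 this)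

/-- A hyperplane reflection is determined by its effect on a single point it moves. -/
theorem IsHyperplaneReflection.eq_reflection {σ : V ≃ₗᵢ[ℝ] V} (h : IsHyperplaneReflection σ)
    {p : V} (hp : σ p ≠ p) : σ = (ℝ ∙ (p - σ p))ᗮ.reflection := by
  obtain ⟨v, hv, rfl⟩ := h
  have h1 : p - (ℝ ∙ v)ᗮ.reflection p = (2 * (inner ℝ v p / ‖v‖ ^ 2)) • v := by
    rw [hyperplaneReflection_apply]; abel
  have h2 : 2 * (inner ℝ v p / ‖v‖ ^ 2) ≠ 0 := by
    intro h0
    rw [h0, zero_smul, sub_eq_zero] at h1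
    exact hp h1.symm
  have h3 : ℝ ∙ (p - (ℝ ∙ v)ᗮ.reflection p) = ℝ ∙ v := by
    rw [h1, Submodule.span_singleton_smul_eq h2.isUnit]
  simp only [h3]

theorem inner_sub_apply_eq_zero {σ : V ≃ₗᵢ[ℝ] V} {z : V} (hz : σ z = z) (p : V) :
    inner ℝ z (p - σ p) = 0 := by
  rw [inner_sub_right, inner_apply_right, inv_apply_eq_of_apply_eq hz, sub_self]

/-- A nontrivial isometry whose fixed space has a one-dimensional complement is a reflection. -/
theorem isHyperplaneReflection_of_sup_eq_top {σ : V ≃ₗᵢ[ℝ] V} (hne : σ ≠ 1) {x : V}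
    (h : fixedSpace σ ⊔ ℝ ∙ x = ⊤) : IsHyperplaneReflection σ := by
  have hx : x - σ x ≠ 0 := by
    intro h0
    refine hne (fixedSpace_eq_top_iff.1 (eq_top_iff.2 (h ▸ sup_le le_rfl ?_)))
    exact (Submodule.span_singleton_le_iff_mem _ _).2 (mem_fixedSpace.2 (sub_eq_zero.1 h0).symm)
  refine ⟨x - σ x, hx, LinearIsometryEquiv.ext fun y => ?_⟩
  obtain ⟨z, hz, w, hw, rfl⟩ := Submodule.mem_sup.1 (h ▸ Submodule.mem_top : y ∈ fixedSpace σ ⊔ ℝ ∙ x)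
  obtain ⟨c, rfl⟩ := Submodule.mem_span_singleton.1 hw
  rw [map_add, map_add, map_smul, map_smul, Submodule.reflection_sub (σ.norm_map x).symm,
    (hyperplaneReflection_apply_eq_self_iff _ _).2 (inner_sub_apply_eq_zero hz x),
    mem_fixedSpace.1 hz]

/-- One normal vector for each reflecting hyperplane of `W`, pointing to the side of `p`. -/
def positiveNormals (W : Subgroup (V ≃ₗᵢ[ℝ] V)) (p : V) : Set V :=
  {u | ∃ σ ∈ W, IsHyperplaneReflection σ ∧ u = p - σ p}

theorem finite_positiveNormals [Finite W] (p : V) : (positiveNormals W p).Finite :=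
  (Set.finite_range fun σ : W => p - (σ : V ≃ₗᵢ[ℝ] V) p).subset <| by
    rintro _ ⟨σ, hσ, -, rfl⟩
    exact ⟨⟨σ, hσ⟩, rfl⟩

theorem reflection_mem_of_mem_positiveNormals {p : V} (hp : IsFree W p) {u : V}
    (hu : u ∈ positiveNormals W p) : (ℝ ∙ u)ᗮ.reflection ∈ W := by
  obtain ⟨σ, hσ, hr, rfl⟩ := hu
  rwa [← hr.eq_reflection fun h => hr.ne_one (hp σ hσ h)]

theorem inner_pos_of_mem_positiveNormals {p : V} (hp : IsFree W p) {u : V}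
    (hu : u ∈ positiveNormals W p) : 0 < inner ℝ p u := by
  obtain ⟨σ, hσ, hr, rfl⟩ := hu
  rw [inner_sub_right, sub_pos]
  exact hp.inner_apply_lt hσ hr.ne_one

/-- A vector orthogonal to all normals is fixed by the group. -/
theorem apply_eq_self_of_inner_positiveNormals (hW : IsFiniteReflectionGroup W) {p : V}
    (hp : IsFree W p) {x : V} (hx : ∀ u ∈ positiveNormals W p, inner ℝ x u = 0)
    {σ : V ≃ₗᵢ[ℝ] V} (hσ : σ ∈ W) : σ x = x := by
  obtain ⟨-, S, hS, rfl⟩ := hW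
  induction hσ using Subgroup.closure_induction with
  | mem s hs =>
    have hsW := Subgroup.subset_closure hs
    rw [(hS s hs).eq_reflection (p := p) fun h => (hS s hs).ne_one (hp s hsW h)]
    exact (hyperplaneReflection_apply_eq_self_iff _ _).2 (hx _ ⟨s, hsW, hS s hs, rfl⟩)
  | one => rfl
  | mul a b _ _ ha hb =>
    change a (b x) = x
    rw [hb, ha]
  | inv a _ ha => exact inv_apply_eq_of_apply_eq ha

section FiniteDimensional

variable [FiniteDimensional ℝ V] [Finite W]

namespace IsFundamentalDomain

/-- A fundamental domain is a chamber of the arrangement of reflecting hyperplanes. -/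
theorem mem_iff_positiveNormals (hF : IsFundamentalDomain W F) {p : V} (hp : p ∈ F)
    (hfree : IsFree W p) (x : V) : x ∈ F ↔ ∀ u ∈ positiveNormals W p, 0 ≤ inner ℝ x u := by
  constructor
  · rintro hx _ ⟨σ, hσ, -, rfl⟩
    rw [inner_sub_right, sub_nonneg]
    exact hF.inner_apply_le hx hp hσ
  intro hx
  classical
  obtain ⟨U, hU, hUF⟩ := hF.1
  have hne : U.Nonempty := closure_nonempty_iff.1 ⟨p, hUF ▸ hp⟩
  -- A start `q` outside these subspaces is free, and the segment from `q` towards `x` can meet,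
  -- before its end, only fixed spaces that are hyperplanes, i.e. those of reflections.
  let K : {σ : W // σ ≠ 1} → Submodule ℝ V := fun σ =>
    if fixedSpace (σ : V ≃ₗᵢ[ℝ] V) ⊔ ℝ ∙ x = ⊤ then fixedSpace (σ : V ≃ₗᵢ[ℝ] V)
    else fixedSpace (σ : V ≃ₗᵢ[ℝ] V) ⊔ ℝ ∙ x
  have hK : ∀ σ, K σ ≠ ⊤ := by
    intro σ
    simp only [K]
    split_ifs with h
    · exact fun h => σ.2 (Subtype.ext (fixedSpace_eq_top_iff.1 h))
    · exact h
  obtain ⟨q, hqU, hqK⟩ := (dense_iInter_compl_submodule K hK).inter_open_nonempty U hU hne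
  have hqF : q ∈ F := hUF ▸ subset_closure hqU
  have hqK' : ∀ σ, q ∉ K σ := fun σ => Set.mem_iInter.1 hqK σ
  have hqfree : IsFree W q := by
    intro σ hσ h
    by_contra hne
    refine hqK' ⟨⟨σ, hσ⟩, fun h => hne (congrArg Subtype.val h)⟩ ?_
    simp only [K]
    split_ifs
    · exact h
    · exact Submodule.mem_sup_left h
  refine hF.mem_of_segment_free hqF fun t ht σ hσ hfix => ?_
  by_contra hne
  by_cases htop : fixedSpace σ ⊔ ℝ ∙ x = ⊤
  · have hr := isHyperplaneReflection_of_sup_eq_top hne htop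
    have hu : p - σ p ∈ positiveNormals W p := ⟨σ, hσ, hr, rfl⟩
    have h1 := inner_sub_apply_eq_zero hfix p
    rw [inner_add_left, real_inner_smul_left, real_inner_smul_left] at h1
    have h2 : 0 ≤ inner ℝ q (p - σ p) := by
      rw [inner_sub_right, sub_nonneg]
      exact hF.inner_apply_le hqF hp hσ
    have h3 : inner ℝ q (p - σ p) ≠ 0 := by
      intro h0
      rw [← hyperplaneReflection_apply_eq_self_iff,
        ← hr.eq_reflection fun h => hne (hfree σ hσ h)] at h0
      exact hne (hqfree σ hσ h0)
    have h4 := mul_pos (sub_pos.2 ht.2) (lt_of_le_of_ne h2 h3.symm)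
    have h5 := mul_nonneg ht.1 (hx _ hu)
    linarith
  · refine hqK' ⟨⟨σ, hσ⟩, fun h => hne (congrArg Subtype.val h)⟩ ?_
    simp only [K, if_neg htop]
    have h1 : (1 - t) • q ∈ fixedSpace σ ⊔ ℝ ∙ x := by
      have h2 : (1 - t) • q = ((1 - t) • q + t • x) + (-t) • x := by
        rw [neg_smul, add_neg_cancel_right]
      rw [h2]
      exact Submodule.add_mem_sup hfix
        (Submodule.smul_mem _ _ (Submodule.mem_span_singleton_self x))
    exact (Submodule.smul_mem_iff _ (sub_pos.2 ht.2).ne').1 h1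

/-- A normal vector of a reflecting hyperplane has constant sign on a fundamental domain. -/
theorem inner_mul_inner_nonneg (hF : IsFundamentalDomain W F) {u : V}
    (hu : (ℝ ∙ u)ᗮ.reflection ∈ W) {x y : V} (hx : x ∈ F) (hy : y ∈ F) :
    0 ≤ inner ℝ x u * inner ℝ y u := by
  rcases eq_or_ne u 0 with rfl | hu0
  · simp
  have h := hF.inner_apply_le hx hy hu
  have hpos : 0 < ‖u‖ ^ 2 := by positivity
  rw [hyperplaneReflection_apply, inner_sub_right, real_inner_smul_right, real_inner_comm y u,
    sub_le_self_iff] at h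
  have : inner ℝ x u * inner ℝ y u = 2⁻¹ * ‖u‖ ^ 2 * (2 * (inner ℝ y u / ‖u‖ ^ 2) * inner ℝ x u) := by
    field_simp
  rw [this]
  positivity

/-- A fundamental domain is cut out by linearly independent normals of reflecting hyperplanes. -/
theorem exists_linearIndependent_normals (hF : IsFundamentalDomain W F) {p : V} (hp : p ∈ F)
    (hfree : IsFree W p) : ∃ Δ : Finset V, ↑Δ ⊆ positiveNormals W p ∧
      LinearIndependent ℝ (fun u : Δ => (u : V)) ∧ ∀ x, x ∈ F ↔ ∀ u ∈ Δ, 0 ≤ inner ℝ x u := by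
  classical
  obtain ⟨Δ, hΔ⟩ := exists_minimal_of_wellFoundedLT
    (fun Δ : Finset V => ↑Δ ⊆ positiveNormals W p ∧ ∀ x, x ∈ F ↔ ∀ u ∈ Δ, 0 ≤ inner ℝ x u)
    ⟨(finite_positiveNormals (W := W) p).toFinset, by simp,
      fun x => by simpa using hF.mem_iff_positiveNormals hp hfree x⟩
  obtain ⟨⟨hsub, hmem⟩, hmin⟩ := hΔ
  refine ⟨Δ, hsub, ?_, hmem⟩
  have hpos : ∀ u ∈ Δ, 0 < inner ℝ p u := fun u hu =>
    inner_pos_of_mem_positiveNormals hfree (hsub hu)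
  -- By minimality some `x` violates only the inequality of `u`; the segment from `p` to `x` crosses
  -- that wall at a multiple of the required point.
  have hfacet : ∀ u ∈ Δ, ∃ y ∈ F, inner ℝ y u = 0 ∧ ∀ v ∈ Δ, v ≠ u → 0 < inner ℝ y v := by
    intro u hu
    obtain ⟨x, hx, hxF⟩ : ∃ x, (∀ v ∈ Δ.erase u, 0 ≤ inner ℝ x v) ∧ x ∉ F := by
      by_contra! hcon
      refine absurd (hmin ⟨fun v hv => hsub (Finset.erase_subset _ _ hv), fun x =>
        ⟨fun hx v hv => (hmem x).1 hx v (Finset.mem_of_mem_erase hv), hcon x⟩⟩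
        (Finset.erase_subset u Δ) hu) (Finset.notMem_erase u Δ)
    have hxu : inner ℝ x u < 0 := by
      by_contra! h
      refine hxF ((hmem x).2 fun v hv => ?_)
      rcases eq_or_ne v u with rfl | hvu
      · exact h
      · exact hx v (Finset.mem_erase.2 ⟨hvu, hv⟩)
    have h0 : inner ℝ (inner ℝ p u • x - inner ℝ x u • p) u = (0 : ℝ) := by
      rw [inner_sub_left, real_inner_smul_left, real_inner_smul_left]; ring
    have h1 : ∀ v ∈ Δ, v ≠ u → 0 < inner ℝ (inner ℝ p u • x - inner ℝ x u • p) v := by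
      intro v hv hvu
      rw [inner_sub_left, real_inner_smul_left, real_inner_smul_left]
      nlinarith [mul_nonneg (hpos u hu).le (hx v (Finset.mem_erase.2 ⟨hvu, hv⟩)),
        mul_pos_of_neg_of_neg hxu (neg_lt_zero.2 (hpos v hv))]
    refine ⟨_, (hmem _).2 fun v hv => ?_, h0, h1⟩
    rcases eq_or_ne v u with rfl | hvu
    · exact h0.ge
    · exact (h1 v hv hvu).le
  -- Pairwise nonacute vectors in an open half-space are linearly independent.
  refine LinearMap.BilinForm.linearIndependent_of_pairwise_le_zero (innerₗ V) ?_ (innerₗ V p) _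
    (fun u => hpos u u.2) ?_
  · intro x hx
    rw [LinearMap.BilinMap.toQuadraticMap_apply, innerₗ_apply_apply, real_inner_self_eq_norm_sq]
    positivity
  rintro ⟨u, hu⟩ ⟨v, hv⟩ huv
  have huv : u ≠ v := fun h => huv (Subtype.ext h)
  rw [innerₗ_apply_apply]
  by_contra! hcon
  obtain ⟨y, hy, hyu, hy'⟩ := hfacet u hu
  obtain ⟨z, hz, hzv, hz'⟩ := hfacet v hv
  -- If `u` and `v` formed an acute angle, the reflected normal would be positive at `y` on the wall
  -- of `u` and negative at `z` on the wall of `v`, so its hyperplane would separate points of `F`.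
  have hr : (ℝ ∙ ((ℝ ∙ u)ᗮ.reflection v))ᗮ.reflection ∈ W := by
    have hu' := reflection_mem_of_mem_positiveNormals hfree (hsub hu)
    rw [hyperplaneReflection_map]
    exact W.mul_mem (W.mul_mem hu' (reflection_mem_of_mem_positiveNormals hfree (hsub hv)))
      (W.inv_mem hu')
  have h := hF.inner_mul_inner_nonneg hr hy hz
  have hu0 : u ≠ 0 := by
    rintro rfl
    simpa using hpos _ hu
  rw [hyperplaneReflection_apply, inner_sub_right, inner_sub_right, real_inner_smul_right,
    real_inner_smul_right, hyu, hzv] at h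
  have h1 : 0 < 2 * (inner ℝ u v / ‖u‖ ^ 2) * inner ℝ z u :=
    mul_pos (by positivity) (hz' u hu huv)
  nlinarith [mul_pos (hy' v hv huv.symm) h1]

end IsFundamentalDomain

end FiniteDimensional

end Walls

end ReflCone

namespace ReflCone

/-! ### Simplicial cones, their faces and translates -/

section Cones

/-- When a nonnegative combination of generators lies in a face, so does every generator with
positive coefficient. -/
theorem isFaceOf_hull_eq {V : Type*} [AddCommGroup V] [Module ℝ V] {s : Set V}
    {G : PointedCone ℝ V} (hG : G.IsFaceOf (PointedCone.hull ℝ s)) :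
    PointedCone.hull ℝ (s ∩ G) = G := by
  refine le_antisymm (Submodule.span_le.2 Set.inter_subset_right) fun x hx => ?_
  obtain ⟨c, hcs, hc, rfl⟩ := PointedCone.mem_hull_set.1 (hG.le hx)
  have hmem : ∀ i ∈ c.support, i ∈ PointedCone.hull ℝ s := fun i hi =>
    PointedCone.subset_hull (hcs hi)
  refine Submodule.sum_mem _ fun i hi => PointedCone.smul_mem _ (hc i) ?_
  refine PointedCone.subset_hull ⟨hcs hi, ?_⟩
  rw [Finsupp.sum, ← Finset.sum_coe_sort] at hx
  exact hG.mem_of_sum_smul_mem (f := fun j : c.support => (j : V)) (c := fun j => c j)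
    (fun j => hmem j j.2) (fun j => hc j) hx ⟨i, hi⟩
    (lt_of_le_of_ne (hc i) (Finsupp.mem_support_iff.1 hi).symm)

theorem isSimplicial_of_isFaceOf {V : Type*} [AddCommGroup V] [Module ℝ V]
    {G K : PointedCone ℝ V} (hK : K.IsSimplicial) (hG : G.IsFaceOf K) : G.IsSimplicial := by
  obtain ⟨s, hs, hli, rfl⟩ := hK
  exact ⟨s ∩ G, hs.inter_of_left _, hli.mono Set.inter_subset_left, isFaceOf_hull_eq hG⟩

theorem finite_faces {V : Type*} [AddCommGroup V] [Module ℝ V] {K : PointedCone ℝ V}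
    (hK : K.IsSimplicial) : {G : PointedCone ℝ V | G.IsFaceOf K}.Finite := by
  obtain ⟨s, hs, -, rfl⟩ := hK
  exact (hs.powerset.image (PointedCone.hull ℝ)).subset fun G hG =>
    ⟨s ∩ G, Set.inter_subset_left, isFaceOf_hull_eq hG⟩

variable {V : Type*} [NormedAddCommGroup V] [InnerProductSpace ℝ V]

theorem isSimplicial_translate {K : PointedCone ℝ V} (hK : K.IsSimplicial) (σ : V ≃ₗᵢ[ℝ] V) :
    (translate σ K).IsSimplicial := by
  obtain ⟨s, hs, hli, rfl⟩ := hK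
  refine ⟨σ '' s, hs.image _, ?_, ?_⟩
  · exact hli.id_imageₛ (f := (σ.toLinearEquiv : V →ₗ[ℝ] V)) σ.injective.injOn
  · exact (Submodule.map_span
      ((σ.toLinearEquiv : V →ₗ[ℝ] V).restrictScalars {c : ℝ // 0 ≤ c}) s).symm

theorem mem_translate {σ : V ≃ₗᵢ[ℝ] V} {K : PointedCone ℝ V} {y : V} :
    y ∈ translate σ K ↔ σ⁻¹ y ∈ K := by
  refine PointedCone.mem_map.trans ⟨?_, fun h => ⟨_, h, σ.apply_symm_apply y⟩⟩
  rintro ⟨x, hx, rfl⟩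
  exact (σ.symm_apply_apply x).symm ▸ hx

theorem translate_mul (σ τ : V ≃ₗᵢ[ℝ] V) (K : PointedCone ℝ V) :
    translate (σ * τ) K = translate σ (translate τ K) := by
  ext x
  rw [mem_translate, mem_translate, mem_translate, mul_inv_rev]
  rfl

theorem translate_inf (σ : V ≃ₗᵢ[ℝ] V) (K L : PointedCone ℝ V) :
    translate σ (K ⊓ L) = translate σ K ⊓ translate σ L := by
  ext x
  simp only [mem_translate, Submodule.mem_inf]

/-- The cone of vectors that have nonnegative inner product with all `b i`. -/
def nonnegCone {ι : Type*} (b : ι → V) : PointedCone ℝ V where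
  carrier := {x | ∀ i, 0 ≤ inner ℝ x (b i)}
  add_mem' hx hy i := by
    rw [inner_add_left]
    exact add_nonneg (hx i) (hy i)
  zero_mem' i := by rw [inner_zero_left]
  smul_mem' c x hx i := by
    change 0 ≤ inner ℝ ((c : ℝ) • x) (b i)
    rw [real_inner_smul_left]
    exact mul_nonneg c.2 (hx i)

theorem mem_nonnegCone {ι : Type*} {b : ι → V} {x : V} :
    x ∈ nonnegCone b ↔ ∀ i, 0 ≤ inner ℝ x (b i) := Iff.rfl

/-- The dual cone of a basis is simplicial. -/
theorem isSimplicial_nonnegCone [FiniteDimensional ℝ V] {ι : Type*} [Finite ι] {b : ι → V}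
    (hli : LinearIndependent ℝ b) (hb : ∀ x, (∀ i, inner ℝ x (b i) = 0) → x = 0) :
    (nonnegCone b).IsSimplicial := by
  have := Fintype.ofFinite ι
  let L : V →ₗ[ℝ] (ι → ℝ) := LinearMap.pi fun i => innerₗ V (b i)
  have hL : ∀ x i, L x i = inner ℝ x (b i) := fun x i => real_inner_comm x (b i)
  have hinj : Function.Injective L := by
    rw [← LinearMap.ker_eq_bot, LinearMap.ker_eq_bot']
    exact fun x hx => hb x fun i => by rw [← hL, hx]; rfl
  have hcard : Module.finrank ℝ V = Module.finrank ℝ (ι → ℝ) :=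
    le_antisymm (LinearMap.finrank_le_finrank_of_injective hinj)
      (by rw [Module.finrank_fintype_fun_eq_card]; exact hli.fintype_card_le_finrank)
  -- The inner products with the `b i` are coordinates on `V`; the corresponding dual basis
  -- generates the cone.
  let e : V ≃ₗ[ℝ] (ι → ℝ) := LinearEquiv.ofInjectiveOfFinrankEq L hinj hcard
  let d : Module.Basis ι ℝ V := Module.Basis.ofEquivFun e
  have he : ∀ x i, d.repr x i = inner ℝ x (b i) := fun x i => hL x i
  refine ⟨Set.range d, Set.finite_range d, d.linearIndependent.linearIndepOn_id, ?_⟩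
  refine le_antisymm (Submodule.span_le.2 ?_) fun x hx => ?_
  · rintro _ ⟨j, rfl⟩ i
    rw [← he, d.repr_self]
    exact Finsupp.single_nonneg.2 zero_le_one i
  · rw [← d.sum_repr x]
    refine Submodule.sum_mem _ fun i _ => PointedCone.smul_mem _ ?_
      (PointedCone.subset_hull ⟨i, rfl⟩)
    rw [he]
    exact hx i

end Cones

/-! ### The cone inside a fundamental domain and its translates -/

section Main

variable {V : Type*} [NormedAddCommGroup V] [InnerProductSpace ℝ V]
  {W : Subgroup (V ≃ₗᵢ[ℝ] V)} {V₁ V₂ : Submodule ℝ V} {C : PointedCone ℝ V} {F : Set V}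

/-- The vectors fixed by an almost irreducible group are those of its trivial part. -/
theorem IsAlmostIrreducible.mem_right (hW : IsAlmostIrreducible W V₁ V₂) {x : V}
    (hx : ∀ σ ∈ W, σ x = x) : x ∈ V₂ := by
  obtain ⟨y, hy, z, hz, rfl⟩ := Submodule.mem_sup.1
    (hW.isCompl.sup_eq_top ▸ Submodule.mem_top : x ∈ V₁ ⊔ V₂)
  have hfix : ∀ σ ∈ W, σ y = y := by
    intro σ hσ
    have h := hx σ hσ
    rwa [map_add, hW.trivial σ hσ z hz, add_left_inj] at h
  -- The line of the fixed component `y` is invariant; if it were all of `V₁`, the action there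
  -- would be trivial.
  rcases hW.irreducible (ℝ ∙ y) ((Submodule.span_singleton_le_iff_mem _ _).2 hy) (by
    intro σ hσ w hw
    obtain ⟨c, rfl⟩ := Submodule.mem_span_singleton.1 hw
    rwa [map_smul, hfix σ hσ]) with h | h
  · rw [Submodule.span_singleton_eq_bot.1 h, zero_add]
    exact hz
  · obtain ⟨σ, hσ, w, hw, hne⟩ := hW.nontrivial
    rw [← h] at hw
    obtain ⟨c, rfl⟩ := Submodule.mem_span_singleton.1 hw
    exact absurd (by rw [map_smul, hfix σ hσ]) hne

theorem IsFundamentalDomain.orbit_inter_eq (hF : IsFundamentalDomain W F) {x x₀ : V}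
    (h : x₀ ∈ orbit W x) (h' : x₀ ∈ F) : orbit W x ∩ F = {x₀} :=
  Set.eq_singleton_iff_unique_mem.2 ⟨⟨h, h'⟩, fun _ hy => (hF.2 x).unique hy ⟨h, h'⟩⟩

variable [FiniteDimensional ℝ V]

/-- Within a fundamental domain the cone is cut out by a single inequality. -/
theorem IsDefiningForm.mem_iff_inner_nonpos [Finite W] (hF : IsFundamentalDomain W F)
    {φ : Module.Dual ℝ V} (hφ : IsDefiningForm W V₁ V₂ C φ) {xφ : V}
    (hxφ : ∀ x : V, φ x = -inner ℝ x xφ) {σ : V ≃ₗᵢ[ℝ] V} (hσ : σ ∈ W) (h₀ : σ xφ ∈ F) {x : V}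
    (hx : x ∈ F) : x ∈ C ↔ inner ℝ x (σ xφ) ≤ 0 := by
  rw [hφ.mem_iff]
  constructor
  · intro h
    have := h σ⁻¹ (W.inv_mem hσ)
    rw [hxφ, ← inner_apply_right] at this
    linarith
  · intro h τ hτ
    have h1 := hF.inner_apply_le hx h₀ (W.mul_mem (W.inv_mem hτ) (W.inv_mem hσ))
    have h2 : (τ⁻¹ * σ⁻¹) (σ xφ) = τ⁻¹ xφ := congrArg (τ⁻¹ ·) (σ.symm_apply_apply xφ)
    rw [h2, inner_apply_right, inv_inv] at h1
    rw [hxφ]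
    linarith

/-- Translates of a cone inside a fundamental domain intersect in common faces. -/
theorem IsFundamentalDomain.inf_translate_isFaceOf [Finite W] (hF : IsFundamentalDomain W F)
    {K : PointedCone ℝ V} (hK : (K : Set V) ⊆ F) {σ τ : V ≃ₗᵢ[ℝ] V} (hσ : σ ∈ W) (hτ : τ ∈ W) :
    (translate σ K ⊓ translate τ K).IsFaceOf (translate σ K) := by
  have key : ∀ ρ ∈ W, (K ⊓ translate ρ K).IsFaceOf K := by
    intro ρ hρ
    -- Two points of `F` in one orbit coincide, so `K` meets its translate exactly in fixed points.
    have hmem : ∀ x ∈ K, (x ∈ translate ρ K ↔ ρ⁻¹ x = x) := by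
      intro x hx
      rw [mem_translate]
      refine ⟨fun h => hF.apply_eq_self (W.inv_mem hρ) (hK hx) (hK h), fun h => ?_⟩
      rwa [h]
    refine PointedCone.IsFaceOf.of_mem_of_add_mem_left inf_le_left fun {x y} hx hy hxy => ?_
    refine ⟨hx, (hmem x hx).2 ?_⟩
    exact hF.apply_eq_self_of_add (W.inv_mem hρ) (hK hx) (hK hy) ((hmem _ hxy.1).1 hxy.2)
  have h := (key (σ⁻¹ * τ) (W.mul_mem (W.inv_mem hσ) hτ)).map_equiv σ.toLinearEquiv
  change (translate σ (K ⊓ translate (σ⁻¹ * τ) K)).IsFaceOf (translate σ K) at h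
  rwa [translate_inf, ← translate_mul, mul_inv_cancel_left] at h

/-- The translates of a simplicial cone inside a fundamental domain form, together with their
faces, a triangulation of their union. -/
theorem IsFundamentalDomain.isTriangulation [Finite W] (hF : IsFundamentalDomain W F)
    {K : PointedCone ℝ V} (hK : (K : Set V) ⊆ F) (hsimp : K.IsSimplicial)
    (hunion : (C : Set V) = ⋃ σ ∈ W, (translate σ K : Set V)) :
    IsTriangulation C {G | ∃ σ ∈ W, G.IsFaceOf (translate σ K)} where
  finite := by
    refine (Set.finite_iUnion fun σ : W =>
      finite_faces (isSimplicial_translate hsimp (σ : V ≃ₗᵢ[ℝ] V))).subset ?_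
    rintro G ⟨σ, hσ, hG⟩
    exact Set.mem_iUnion.2 ⟨⟨σ, hσ⟩, hG⟩
  simplicial := by
    rintro G ⟨σ, -, hG⟩
    exact isSimplicial_of_isFaceOf (isSimplicial_translate hsimp σ) hG
  face_mem := by
    rintro G ⟨σ, hσ, hG⟩ G' hG'
    exact ⟨σ, hσ, hG'.trans hG⟩
  inter_face := by
    rintro G ⟨σ, hσ, hG⟩ G' ⟨τ, hτ, hG'⟩
    have h := hG.inf hG'
    have h1 := h.trans (hF.inf_translate_isFaceOf hK hσ hτ)
    have h2 := h.trans (inf_comm (translate τ K) _ ▸ hF.inf_translate_isFaceOf hK hτ hσ)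
    exact ⟨(h1.isFaceOf_iff_le hG).2 inf_le_left, (h2.isFaceOf_iff_le hG').2 inf_le_right⟩
  union := by
    rw [hunion]
    refine Set.Subset.antisymm (Set.iUnion₂_subset fun σ hσ => ?_) (Set.iUnion₂_subset ?_)
    · exact Set.subset_biUnion_of_mem (u := fun G : PointedCone ℝ V => (G : Set V))
        (⟨σ, hσ, .refl _⟩ : translate σ K ∈ {G | ∃ σ ∈ W, G.IsFaceOf (translate σ K)})
    · rintro G ⟨σ, hσ, hG⟩ x hx
      exact Set.mem_iUnion₂.2 ⟨σ, hσ, hG.le hx⟩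

/-- The part of a monoconditional cone in a fundamental domain is the dual cone of a basis. -/
theorem IsDefiningForm.exists_isSimplicial (hW : IsAlmostIrreducible W V₁ V₂)
    (hF : IsFundamentalDomain W F) {φ : Module.Dual ℝ V} (hφ : IsDefiningForm W V₁ V₂ C φ) :
    ∃ K : PointedCone ℝ V, (K : Set V) = (C : Set V) ∩ F ∧ K.IsSimplicial := by
  have hfin : Finite W := hW.reflectionGroup.1
  obtain ⟨p, hp, hfree⟩ := hF.exists_isFree
  obtain ⟨Δ, hΔ, hli, hmem⟩ := hF.exists_linearIndependent_normals hp hfree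
  obtain ⟨xφ, hxφ⟩ : ∃ xφ : V, ∀ x, φ x = -inner ℝ x xφ := by
    refine ⟨-(InnerProductSpace.toDual ℝ V).symm (LinearMap.toContinuousLinearMap φ), fun x => ?_⟩
    rw [inner_neg_right, neg_neg, real_inner_comm, InnerProductSpace.toDual_symm_apply]
    rfl
  obtain ⟨σ, hσ, h₀⟩ := hF.exists_mem xφ
  obtain ⟨e, he, heφ⟩ := SetLike.not_le_iff_exists.1 hφ.not_le_right
  have he₀ : inner ℝ e (-σ xφ) ≠ 0 := by
    rwa [inner_neg_right, inner_apply_right, hW.trivial _ (W.inv_mem hσ) e he, ← hxφ]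
  have hΔe : ∀ u ∈ Δ, inner ℝ e u = 0 := by
    intro u hu
    obtain ⟨τ, hτ, -, rfl⟩ := hΔ hu
    exact inner_sub_apply_eq_zero (hW.trivial τ hτ e he) p
  let b : Option Δ → V := fun o => o.casesOn' (-σ xφ) fun u => (u : V)
  have hb : LinearIndependent ℝ b := by
    -- The vector `e ∈ V₂` is orthogonal to every normal in `Δ` but not to `σ xφ`.
    refine linearIndependent_option'.2 ⟨hli, fun h => he₀ ?_⟩
    have hle : Submodule.span ℝ (Set.range fun u : Δ => (u : V)) ≤ (ℝ ∙ e)ᗮ := by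
      rw [Submodule.span_le]
      rintro _ ⟨u, rfl⟩
      exact Submodule.mem_orthogonal_singleton_iff_inner_right.2 (hΔe u u.2)
    exact Submodule.mem_orthogonal_singleton_iff_inner_right.1 (hle h)
  have hspan : ∀ x, (∀ i, inner ℝ x (b i) = 0) → x = 0 := by
    intro x hx
    have hxu : ∀ u ∈ Δ, inner ℝ x u = 0 := fun u hu => hx (some ⟨u, hu⟩)
    -- Having both `x` and `-x` in `F` passes from orthogonality to `Δ` to orthogonality to all
    -- normals, so `x` is fixed by `W`.
    have hxF : x ∈ F := (hmem x).2 fun u hu => (hxu u hu).ge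
    have hxF' : -x ∈ F := (hmem _).2 fun u hu => by rw [inner_neg_left, hxu u hu, neg_zero]
    have hx₂ : x ∈ V₂ := by
      refine hW.mem_right fun τ hτ =>
        apply_eq_self_of_inner_positiveNormals hW.reflectionGroup hfree (fun u hu => ?_) hτ
      have h1 := (hF.mem_iff_positiveNormals hp hfree x).1 hxF u hu
      have h2 := (hF.mem_iff_positiveNormals hp hfree _).1 hxF' u hu
      rw [inner_neg_left] at h2
      linarith
    have he0 : (⟨e, he⟩ : V₂) ≠ 0 := by
      intro h
      apply he₀
      rw [show e = 0 from congrArg Subtype.val h, inner_zero_left]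
    obtain ⟨c, hc⟩ := exists_smul_eq_of_finrank_eq_one hW.finrank_eq_one he0 ⟨x, hx₂⟩
    obtain rfl : c • e = x := congrArg Subtype.val hc
    have h := hx none
    rw [real_inner_smul_left] at h
    rw [(mul_eq_zero.1 h).resolve_right he₀, zero_smul]
  refine ⟨nonnegCone b, ?_, isSimplicial_nonnegCone hb hspan⟩
  ext x
  have hbx : x ∈ nonnegCone b ↔ inner ℝ x (σ xφ) ≤ 0 ∧ x ∈ F := by
    rw [mem_nonnegCone, Option.forall, hmem]
    refine and_congr ?_ ⟨fun h u hu => h ⟨u, hu⟩, fun h u => h u u.2⟩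
    change 0 ≤ inner ℝ x (-σ xφ) ↔ _
    rw [inner_neg_right, neg_nonneg]
  rw [SetLike.mem_coe, hbx, Set.mem_inter_iff, SetLike.mem_coe]
  exact and_congr_left fun hx => (hφ.mem_iff_inner_nonpos hF hxφ hσ h₀ hx).symm

end Main

end ReflCone

theorem mainTheorem2 {V : Type*} [NormedAddCommGroup V] [InnerProductSpace ℝ V]
    [FiniteDimensional ℝ V] (W : Subgroup (V ≃ₗᵢ[ℝ] V)) (V₁ V₂ : Submodule ℝ V)
    (hW : ReflCone.IsAlmostIrreducible W V₁ V₂)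
    (C : PointedCone ℝ V) (hC : ReflCone.IsMonoconditional W V₁ V₂ C)
    (F : Set V) (hF : ReflCone.IsFundamentalDomain W F) :
    ∃ Cplus : PointedCone ℝ V,
      (Cplus : Set V) = (C : Set V) ∩ F ∧
      Cplus.IsSimplicial ∧
      (∀ φ : Module.Dual ℝ V, ReflCone.IsDefiningForm W V₁ V₂ C φ →
        ∀ xφ : V, (∀ x : V, φ x = -inner ℝ x xφ) →
          ∃ x₀ : V, ReflCone.orbit W xφ ∩ F = {x₀} ∧
            (Cplus : Set V) = {x | x ∈ F ∧ inner ℝ x x₀ ≤ 0}) ∧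
      (C : Set V) = (⋃ σ ∈ W, (ReflCone.translate σ Cplus : Set V)) ∧
      ReflCone.IsTriangulation C
        {G | ∃ σ ∈ W, G.IsFaceOf (ReflCone.translate σ Cplus)} := by
  have hfin : Finite W := hW.reflectionGroup.1
  obtain ⟨⟨-, hinv⟩, φ₀, hφ₀⟩ := hC
  obtain ⟨K, hK, hsimp⟩ := hφ₀.exists_isSimplicial hW hF
  have hKF : (K : Set V) ⊆ F := hK ▸ Set.inter_subset_right
  have hunion : (C : Set V) = ⋃ σ ∈ W, (ReflCone.translate σ K : Set V) := by
    ext x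
    simp only [Set.mem_iUnion, SetLike.mem_coe, ReflCone.mem_translate, exists_prop]
    constructor
    · intro hx
      obtain ⟨σ, hσ, hσx⟩ := hF.exists_mem x
      refine ⟨σ⁻¹, W.inv_mem hσ, ?_⟩
      rw [inv_inv, ← SetLike.mem_coe, hK]
      refine ⟨?_, hσx⟩
      rwa [← hinv _ (W.inv_mem hσ), ReflCone.mem_translate, inv_inv] at hx
    · rintro ⟨σ, hσ, hx⟩
      rw [← SetLike.mem_coe, hK] at hx
      rw [← hinv σ hσ, ReflCone.mem_translate]
      exact hx.1
  refine ⟨K, hK, hsimp, fun φ hφ xφ hxφ => ?_, hunion, hF.isTriangulation hKF hsimp hunion⟩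
  obtain ⟨σ, hσ, h₀⟩ := hF.exists_mem xφ
  refine ⟨σ xφ, hF.orbit_inter_eq (ReflCone.smul_mem_orbit hσ xφ) h₀, ?_⟩
  rw [hK]
  ext x
  exact and_comm.trans (and_congr_right fun hx => hφ.mem_iff_inner_nonpos hF hxφ hσ h₀ hx)
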